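/- Let $S$ be a set of $N \ge 3$ points in the plane in general position, that is, no three points of $S$ are collinear. A plane graph on $S$ is a simple graph with vertex set $S$ whose edges are drawn as straight line segments between the corresponding points, such that no two distinct edges meet at a point of their relative interiors. Let $\mathcal{P}(S)$ be the (finite) set of all plane graphs on the labeled point set $S$. For $G \in \mathcal{P}(S)$ and $i \ge 0$, let $v_i(G)$ be the number of vertices of degree $i$ in $G$, and let $$\hat v_i(S) = \frac{1}{|\mathcal{P}(S)|}\sum_{G \in \mathcal{P}(S)} v_i(G)$$ be the expected value of $v_i(G)$ for $G$ chosen uniformly at random from $\mathcal{P}(S)$. Then $$\hat v_2(S) + \hat v_3(S) \ \ge\ \frac{N}{24}.$$ -/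

import Mathlib

/-- The Euclidean plane. -/
abbrev Plane : Type := EuclideanSpace ℝ (Fin 2)

/-- A finite set of points is in general position if no three of its points are collinear. -/
def InGeneralPosition (S : Finset Plane) : Prop :=
  ∀ p ∈ S, ∀ q ∈ S, ∀ r ∈ S, p ≠ q → p ≠ r → q ≠ r → ¬ Collinear ℝ ({p, q, r} : Set Plane)

/-- A graph with vertex set `S`, whose edges are drawn as straight segments between the
corresponding points, is a plane (crossing-free straight-edge) graph if no two distinct edges
meet at a point of their relative interiors. -/
def IsPlaneGraph {S : Finset Plane} (G : SimpleGraph S) : Prop :=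
  ∀ a b c d : S, G.Adj a b → G.Adj c d → s(a, b) ≠ s(c, d) →
    Disjoint (openSegment ℝ (a : Plane) (b : Plane)) (openSegment ℝ (c : Plane) (d : Plane))

open Classical in
/-- The finite set of all plane graphs on the (labeled) point set `S`. -/
noncomputable def planeGraphs (S : Finset Plane) : Finset (SimpleGraph S) :=
  Finset.univ.filter fun G => IsPlaneGraph G

open Classical in
/-- The number of vertices of degree `i` in `G`. -/
noncomputable def numDegree {S : Finset Plane} (G : SimpleGraph S) (i : ℕ) : ℕ :=
  (Finset.univ.filter fun p : S => G.degree p = i).card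

/-- The expected number of vertices of degree `i` in a graph that is chosen uniformly at random
from the set of all plane graphs on `S`. -/
noncomputable def expectedNumDegree (S : Finset Plane) (i : ℕ) : ℝ :=
  (∑ G ∈ planeGraphs S, (numDegree G i : ℝ)) / ((planeGraphs S).card : ℝ)

/-- The empty graph is plane, so the average above is over a nonempty set. -/
theorem planeGraphs_nonempty (S : Finset Plane) : (planeGraphs S).Nonempty := by
  classical
  refine ⟨⊥, ?_⟩
  simp only [planeGraphs, Finset.mem_filter, Finset.mem_univ, true_and]
  intro a b c d h
  exact absurd h (by simp)

/-! Fix a point `p` and group the plane graphs by what remains after deleting the edges at `p`.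
Within a group, the neighbourhood of `p` is an arbitrary subset of the `k` points visible from `p`,
so degree `m` occurs `k.choose m` times (`sum_planeGraphs_fiber`). Since `2 ≤ k`
(`two_le_card_visiblePoints`), the weight `24·[m = 2 or 3] + m - 7` has nonnegative sum over each
group (`sum_choose_mul_degreeWeight_nonneg`). Adding over all `p`, a graph receives `24 (v₂ + v₃)`
plus its degree sum minus `7N`. A plane graph has degree sum at most `6N`
(`IsPlaneDrawing.sum_degree_le`), so `24 (v₂ + v₃) - N` is nonnegative on average. Both geometric
inputs are proved by a left-to-right sweep in coordinates without vertical chords: edges are graphs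
of affine functions whose vertical order cannot change. The edge bound charges every edge to a
vertex, at most three times per vertex. Visibility holds because the leftmost vertex right of `p`
that no edge separates from `p` can be joined to it. -/

/-! ### Straight-line drawings in coordinates -/

/-- The slope of the line through the points `a` and `b`, in the coordinates `X`, `Y`. -/
noncomputable def chordSlope {V : Type*} (X Y : V → ℝ) (a b : V) : ℝ :=
  (Y b - Y a) / (X b - X a)

/-- The height over `x` of the line through the points `a` and `b`. -/
noncomputable def chordHeight {V : Type*} (X Y : V → ℝ) (a b : V) (x : ℝ) : ℝ :=
  Y a + (x - X a) * chordSlope X Y a b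

/-- A straight-line drawing in general position without vertical edges and without crossings. -/
structure IsPlaneDrawing {V : Type*} (X Y : V → ℝ) (G : SimpleGraph V) : Prop where
  injective : Function.Injective X
  general : ∀ a b c : V, a ≠ b → a ≠ c → b ≠ c → chordHeight X Y a b (X c) ≠ Y c
  noncrossing : ∀ a b c d : V, G.Adj a b → G.Adj c d → X a < X b → X c < X d →
    s(a, b) ≠ s(c, d) → ∀ x, X a < x → x < X b → X c < x → x < X d →
    chordHeight X Y a b x ≠ chordHeight X Y c d x

section Chords

variable {V : Type*} {X Y : V → ℝ} {a b c d : V} {x : ℝ}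

theorem chordSlope_comm : chordSlope X Y a b = chordSlope X Y b a := by
  unfold chordSlope
  rw [← neg_sub (Y a), ← neg_sub (X a), neg_div_neg_eq]

theorem chordHeight_left : chordHeight X Y a b (X a) = Y a := by
  simp [chordHeight]

theorem chordHeight_comm (h : X a ≠ X b) : chordHeight X Y a b x = chordHeight X Y b a x := by
  have h1 : X b - X a ≠ 0 := sub_ne_zero.2 h.symm
  have h2 : X a - X b ≠ 0 := sub_ne_zero.2 h
  unfold chordHeight chordSlope
  rw [← neg_sub (X b) (X a), div_neg]
  field_simp
  ring

theorem chordHeight_right (h : X a ≠ X b) : chordHeight X Y a b (X b) = Y b := by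
  rw [chordHeight_comm h, chordHeight_left]

theorem chordHeight_eq_right (h : X a ≠ X b) :
    chordHeight X Y a b x = Y b + (x - X b) * chordSlope X Y a b := by
  rw [chordHeight_comm h, chordHeight, chordSlope_comm]

theorem chordSlope_neg : chordSlope X (-Y) a b = -chordSlope X Y a b := by
  simp only [chordSlope, Pi.neg_apply]; ring

theorem chordHeight_neg : chordHeight X (-Y) a b x = -chordHeight X Y a b x := by
  simp only [chordHeight, chordSlope_neg, Pi.neg_apply]; ring

/-- Applied to the difference of two chords: a change of vertical order produces a crossing strictly
between the two abscissas. -/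
theorem exists_zero_of_affine {α β x₀ x₁ : ℝ} (h₀ : α + β * x₀ < 0) (h₁ : 0 < α + β * x₁) :
    ∃ x, min x₀ x₁ < x ∧ x < max x₀ x₁ ∧ α + β * x = 0 := by
  have hβ : β ≠ 0 := by rintro rfl; linarith
  have hz : α + β * (-α / β) = 0 := by field_simp; ring
  refine ⟨-α / β, ?_, ?_, hz⟩
  · rcases lt_or_gt_of_ne hβ with h | h
    · exact min_lt_of_right_lt (by by_contra! hc; nlinarith)
    · exact min_lt_of_left_lt (by by_contra! hc; nlinarith)
  · rcases lt_or_gt_of_ne hβ with h | h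
    · exact lt_max_of_lt_left (by by_contra! hc; nlinarith)
    · exact lt_max_of_lt_right (by by_contra! hc; nlinarith)

/-- Over the interior of an interval, a chord stays below another one if it starts strictly below
and ends weakly below. -/
theorem chordHeight_lt_of_between {x₀ x₁ : ℝ} (h₀ : x₀ ≤ x) (h₁ : x < x₁)
    (hlt : chordHeight X Y a b x₀ < chordHeight X Y c d x₀)
    (hle : chordHeight X Y a b x₁ ≤ chordHeight X Y c d x₁) :
    chordHeight X Y a b x < chordHeight X Y c d x := by
  unfold chordHeight at *
  by_contra! hc
  rcases h₀.eq_or_lt with rfl | h₀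
  · linarith
  -- The value at `x` is the average of the end values with weights `x₁ - x` and `x - x₀`, cleared
  -- of denominators.
  · nlinarith [mul_lt_mul_of_pos_right hlt (sub_pos.2 h₁),
      mul_le_mul_of_nonneg_right hle (sub_pos.2 h₀).le,
      mul_le_mul_of_nonneg_right hc (sub_pos.2 (h₀.trans h₁)).le]

end Chords

namespace IsPlaneDrawing

variable {V : Type*} {X Y : V → ℝ} {G : SimpleGraph V}

/-- Reflection in the horizontal axis; it turns each statement about "above" into one about "below".
-/
theorem neg (D : IsPlaneDrawing X Y G) : IsPlaneDrawing X (-Y) G where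
  injective := D.injective
  general a b c h1 h2 h3 := by
    rw [chordHeight_neg]
    simpa using D.general a b c h1 h2 h3
  noncrossing a b c d h1 h2 h3 h4 h5 x h6 h7 h8 h9 := by
    rw [chordHeight_neg, chordHeight_neg]
    simpa using D.noncrossing a b c d h1 h2 h3 h4 h5 x h6 h7 h8 h9

theorem chordSlope_ne (D : IsPlaneDrawing X Y G) {a b c : V} (hab : a ≠ b) (hac : a ≠ c)
    (hbc : b ≠ c) : chordSlope X Y a b ≠ chordSlope X Y a c := by
  intro h
  apply D.general a b c hab hac hbc
  rw [chordHeight, h]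
  exact chordHeight_right (fun h => hac (D.injective h))

/-- Two edges keep their vertical order over their common range. -/
theorem chordHeight_le_of_lt (D : IsPlaneDrawing X Y G) {a b c d : V} (hab : G.Adj a b)
    (hcd : G.Adj c d) {x₀ x₁ : ℝ} (ha₀ : X a ≤ x₀) (hb₀ : x₀ ≤ X b) (hc₀ : X c ≤ x₀)
    (hd₀ : x₀ ≤ X d) (ha₁ : X a ≤ x₁) (hb₁ : x₁ ≤ X b) (hc₁ : X c ≤ x₁) (hd₁ : x₁ ≤ X d)
    (h : chordHeight X Y a b x₀ < chordHeight X Y c d x₀) :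
    chordHeight X Y a b x₁ ≤ chordHeight X Y c d x₁ := by
  by_contra! hc
  have hlt_ab : X a < X b :=
    lt_of_le_of_ne (ha₀.trans hb₀) (fun e => hab.ne (D.injective e))
  have hlt_cd : X c < X d :=
    lt_of_le_of_ne (hc₀.trans hd₀) (fun e => hcd.ne (D.injective e))
  have hne : s(a, b) ≠ s(c, d) := by
    intro e
    rcases Sym2.eq_iff.1 e with ⟨rfl, rfl⟩ | ⟨rfl, rfl⟩
    · exact lt_irrefl _ h
    · exact lt_asymm hlt_ab hlt_cd
  obtain ⟨x, hx1, hx2, hx⟩ := exists_zero_of_affine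
    (α := (Y a - X a * chordSlope X Y a b) - (Y c - X c * chordSlope X Y c d))
    (β := chordSlope X Y a b - chordSlope X Y c d) (x₀ := x₀) (x₁ := x₁)
    (by unfold chordHeight at h; linarith) (by unfold chordHeight at hc; linarith)
  refine D.noncrossing a b c d hab hcd hlt_ab hlt_cd hne x ((le_min ha₀ ha₁).trans_lt hx1)
    (hx2.trans_le (max_le hb₀ hb₁)) ((le_min hc₀ hc₁).trans_lt hx1)
    (hx2.trans_le (max_le hd₀ hd₁)) ?_
  unfold chordHeight
  linarith

/-- The starting abscissa must be interior to both edges: equality there then forces the edges to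
coincide, whereas at a common endpoint it would say nothing. -/
theorem chordHeight_le_of_le (D : IsPlaneDrawing X Y G) {a b c d : V} (hab : G.Adj a b)
    (hcd : G.Adj c d) {x₀ x₁ : ℝ} (ha₀ : X a < x₀) (hb₀ : x₀ < X b) (hc₀ : X c < x₀)
    (hd₀ : x₀ < X d) (ha₁ : X a ≤ x₁) (hb₁ : x₁ ≤ X b) (hc₁ : X c ≤ x₁) (hd₁ : x₁ ≤ X d)
    (h : chordHeight X Y a b x₀ ≤ chordHeight X Y c d x₀) :
    chordHeight X Y a b x₁ ≤ chordHeight X Y c d x₁ := by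
  rcases h.lt_or_eq with h | h
  · exact D.chordHeight_le_of_lt hab hcd ha₀.le hb₀.le hc₀.le hd₀.le ha₁ hb₁ hc₁ hd₁ h
  · have hs : s(a, b) = s(c, d) := by
      by_contra hne
      exact D.noncrossing a b c d hab hcd (ha₀.trans hb₀) (hc₀.trans hd₀) hne x₀ ha₀ hb₀ hc₀ hd₀ h
    rcases Sym2.eq_iff.1 hs with ⟨rfl, rfl⟩ | ⟨rfl, rfl⟩
    · rfl
    · exact absurd (ha₀.trans hb₀) (lt_asymm (hc₀.trans hd₀))

end IsPlaneDrawing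

/-! ### The number of edges -/

/-- The edges from `v` to `a` and `b` both go to the right and are consecutive at `v`, with `b`
above `a`, and `w` is the leftmost vertex, apart from `v`, of the strip between them. -/
structure IsWedge {V : Type*} (X Y : V → ℝ) (G : SimpleGraph V) (v a b w : V) : Prop where
  adj_lower : G.Adj v a
  adj_upper : G.Adj v b
  slope_lt : chordSlope X Y v a < chordSlope X Y v b
  consecutive : ∀ c, G.Adj v c → X v < X c →
    chordSlope X Y v c ≤ chordSlope X Y v a ∨ chordSlope X Y v b ≤ chordSlope X Y v c
  lt_apex : X v < X w
  le_lower : X w ≤ X a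
  le_upper : X w ≤ X b
  lower_le : chordHeight X Y v a (X w) ≤ Y w
  le_upper_height : Y w ≤ chordHeight X Y v b (X w)
  leftmost : ∀ u, X v < X u → X u < X w → chordHeight X Y v a (X u) ≤ Y u →
    chordHeight X Y v b (X u) < Y u

namespace IsWedge

variable {V : Type*} {X Y : V → ℝ} {G : SimpleGraph V} {v a b w u : V}

theorem neg (W : IsWedge X Y G v a b w) : IsWedge X (-Y) G v b a w where
  adj_lower := W.adj_upper
  adj_upper := W.adj_lower
  slope_lt := by simpa only [chordSlope_neg, neg_lt_neg_iff] using W.slope_lt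
  consecutive c h1 h2 := by
    simpa only [chordSlope_neg, neg_le_neg_iff, or_comm] using W.consecutive c h1 h2
  lt_apex := W.lt_apex
  le_lower := W.le_upper
  le_upper := W.le_lower
  lower_le := by simpa only [chordHeight_neg, Pi.neg_apply, neg_le_neg_iff] using W.le_upper_height
  le_upper_height := by simpa only [chordHeight_neg, Pi.neg_apply, neg_le_neg_iff] using W.lower_le
  leftmost c h1 h2 h3 := by
    simp only [chordHeight_neg, Pi.neg_apply, neg_le_neg_iff, neg_lt_neg_iff] at h3 ⊢
    by_contra! hc
    exact absurd (W.leftmost c h1 h2 hc) (not_lt.2 h3)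

/-- An edge that ends at the first vertex `w` of a wedge from the left, below the upper edge,
cannot arrive from above the apex or from above the upper edge. -/
theorem not_above (D : IsPlaneDrawing X Y G) (W : IsWedge X Y G v a b w)
    (hlt : Y w < chordHeight X Y v b (X w)) (hadj : G.Adj u w) (hu : X u < X w)
    (h : (X u ≤ X v ∧ Y v < chordHeight X Y u w (X v)) ∨
      (X v ≤ X u ∧ chordHeight X Y v b (X u) < Y u)) : False := by
  have hw : chordHeight X Y u w (X w) = Y w := chordHeight_right hu.ne
  -- In both cases the edge `u w` is strictly above `v b` at the left end of their common range, but
  -- strictly below it at `X w`.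
  rcases h with ⟨huv, h⟩ | ⟨huv, h⟩
  · have := D.chordHeight_le_of_lt W.adj_upper hadj le_rfl (W.lt_apex.le.trans W.le_upper) huv
      W.lt_apex.le W.lt_apex.le W.le_upper hu.le le_rfl (by rwa [chordHeight_left])
    linarith
  · have := D.chordHeight_le_of_lt W.adj_upper hadj huv (hu.le.trans W.le_upper) le_rfl
      hu.le W.lt_apex.le W.le_upper hu.le le_rfl (by rwa [chordHeight_left])
    linarith

theorem lower_ne_upper (W : IsWedge X Y G v a b w) : a ≠ b := by
  rintro rfl
  exact lt_irrefl _ W.slope_lt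

theorem lt_upper_height (D : IsPlaneDrawing X Y G) (W : IsWedge X Y G v a b w) (hwb : w ≠ b) :
    Y w < chordHeight X Y v b (X w) :=
  lt_of_le_of_ne W.le_upper_height (D.general v b w W.adj_upper.ne
    (fun e => W.lt_apex.ne (congrArg X e)) hwb.symm).symm

theorem lower_lt (D : IsPlaneDrawing X Y G) (W : IsWedge X Y G v a b w) (hwa : w ≠ a) :
    chordHeight X Y v a (X w) < Y w :=
  lt_of_le_of_ne W.lower_le (D.general v a w W.adj_lower.ne
    (fun e => W.lt_apex.ne (congrArg X e)) hwa.symm)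

/-- If the first vertex of a wedge is its lower end, then the lower edge is the uppermost edge that
arrives there from the left. -/
theorem chordSlope_le (D : IsPlaneDrawing X Y G) (W : IsWedge X Y G v a b a) (hadj : G.Adj u a)
    (hu : X u < X a) : chordSlope X Y v a ≤ chordSlope X Y u a := by
  by_contra! hc
  -- With the smaller slope, `u a` runs above `v a` to the left of `a`. So it passes above `v`, or
  -- else `u` lies above `v a`, hence above `v b` because the strip has no vertex before `a`.
  refine W.not_above D (W.lt_upper_height D W.lower_ne_upper) hadj hu ?_
  rcases le_or_gt (X u) (X v) with huv | huv
  · refine Or.inl ⟨huv, ?_⟩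
    have h1 : chordHeight X Y v a (X v) = Y v := chordHeight_left
    rw [chordHeight_eq_right W.lt_apex.ne] at h1
    rw [chordHeight_eq_right hu.ne]
    nlinarith [W.lt_apex]
  · refine Or.inr ⟨huv.le, W.leftmost u huv hu ?_⟩
    have h1 : chordHeight X Y u a (X u) = Y u := chordHeight_left
    rw [chordHeight_eq_right hu.ne] at h1
    rw [chordHeight_eq_right W.lt_apex.ne]
    nlinarith

/-- Both lower edges are the uppermost arrival at `a`, and general position leaves only one edge of
that slope. -/
theorem lower_unique (D : IsPlaneDrawing X Y G) {v' b' : V} (W : IsWedge X Y G v a b a)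
    (W' : IsWedge X Y G v' a b' a) : v = v' := by
  by_contra hne
  refine D.chordSlope_ne W.adj_lower.ne.symm W'.adj_lower.ne.symm hne ?_
  rw [chordSlope_comm, chordSlope_comm (b := v')]
  exact le_antisymm (W.chordSlope_le D W'.adj_lower W'.lt_apex)
    (W'.chordSlope_le D W.adj_lower W.lt_apex)

/-- If the first vertex of a wedge is not an end of its edges, no edge arrives there from the
left. -/
theorem not_adj_left (D : IsPlaneDrawing X Y G) (W : IsWedge X Y G v a b w) (hwa : w ≠ a)
    (hwb : w ≠ b) (hu : X u < X w) : ¬ G.Adj u w := by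
  intro hadj
  have hlo := W.lower_lt D hwa
  have hup := W.lt_upper_height D hwb
  rcases eq_or_ne u v with rfl | huv
  · have h1 : chordHeight X Y u w (X w) = Y w := chordHeight_right hu.ne
    unfold chordHeight at h1 hlo hup
    rcases W.consecutive w hadj W.lt_apex with h | h <;> nlinarith
  -- The edge passes above or below the apex, or starts above or below the strip; the two lower
  -- cases are reflections of the upper ones.
  · have key : (X u ≤ X v ∧ Y v < chordHeight X Y u w (X v)) ∨
      (X v ≤ X u ∧ chordHeight X Y v b (X u) < Y u) ∨
      (X u ≤ X v ∧ chordHeight X Y u w (X v) < Y v) ∨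
      (X v ≤ X u ∧ Y u < chordHeight X Y v a (X u)) := by
      rcases le_or_gt (X u) (X v) with h | h
      · have := D.general u w v hadj.ne huv (fun e => W.lt_apex.ne (congrArg X e.symm))
        rcases lt_or_gt_of_ne this with h' | h'
        · exact Or.inr (Or.inr (Or.inl ⟨h, h'⟩))
        · exact Or.inl ⟨h, h'⟩
      · rcases lt_or_ge (Y u) (chordHeight X Y v a (X u)) with h' | h'
        · exact Or.inr (Or.inr (Or.inr ⟨h.le, h'⟩))
        · exact Or.inr (Or.inl ⟨h.le, W.leftmost u h hu h'⟩)
    rcases key with h | h | h | h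
    · exact W.not_above D hup hadj hu (Or.inl h)
    · exact W.not_above D hup hadj hu (Or.inr h)
    · refine W.neg.not_above D.neg (by simpa [chordHeight_neg] using hlo) hadj hu (Or.inl ?_)
      simpa [chordHeight_neg] using h
    · refine W.neg.not_above D.neg (by simpa [chordHeight_neg] using hlo) hadj hu (Or.inr ?_)
      simpa [chordHeight_neg] using h

/-- Consecutive edges at `v` bound half-open slope intervals; two such intervals that overlap have
the same lower end. -/
theorem lower_eq_of_apex_eq (D : IsPlaneDrawing X Y G) {a' b' w' : V} (W : IsWedge X Y G v a b w)
    (W' : IsWedge X Y G v a' b' w')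
    (h : chordSlope X Y v a' < chordSlope X Y v b)
    (h' : chordSlope X Y v a < chordSlope X Y v b') : a = a' := by
  by_contra hne
  have h1 := W.consecutive a' W'.adj_lower (W'.lt_apex.trans_le W'.le_lower)
  have h2 := W'.consecutive a W.adj_lower (W.lt_apex.trans_le W.le_lower)
  refine D.chordSlope_ne W.adj_lower.ne W'.adj_lower.ne hne (le_antisymm ?_ ?_)
  · exact h2.resolve_right (not_le.2 h')
  · exact h1.resolve_right (not_le.2 h)

theorem slope_lt_upper (W : IsWedge X Y G v a b w)
    (hwb : Y w < chordHeight X Y v b (X w)) : chordSlope X Y v w < chordSlope X Y v b := by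
  have h1 : chordHeight X Y v w (X w) = Y w := chordHeight_right W.lt_apex.ne
  unfold chordHeight at h1 hwb
  have := W.lt_apex
  by_contra! hc
  nlinarith

theorem lower_le_slope (W : IsWedge X Y G v a b w) :
    chordSlope X Y v a ≤ chordSlope X Y v w := by
  have h1 : chordHeight X Y v w (X w) = Y w := chordHeight_right W.lt_apex.ne
  have h2 := W.lower_le
  unfold chordHeight at h1 h2
  have := W.lt_apex
  by_contra! hc
  nlinarith

/-- Two wedges with the same interior first vertex cannot have their apices one after the other. -/
theorem not_apex_lt (D : IsPlaneDrawing X Y G) {v' a' b' : V} (W : IsWedge X Y G v a b w)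
    (W' : IsWedge X Y G v' a' b' w) (hwa : w ≠ a) (hwb : w ≠ b) (hwa' : w ≠ a') (hwb' : w ≠ b') :
    ¬ X v < X v' := by
  intro hlt
  have hlo := W.lower_lt D hwa
  have hup := W.lt_upper_height D hwb
  have hlo' := W'.lower_lt D hwa'
  have hup' := W'.lt_upper_height D hwb'
  have := W'.lt_apex
  have e1 := W.le_lower
  have e2 := W.le_upper
  have e3 := W'.le_lower
  have e4 := W'.le_upper
  -- As `w` is the first vertex of the strip at `v`, the apex `v'` lies below `v a` or above `v b`.
  -- The edge from `v'` passing on the far side of `w` would then have to cross that edge.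
  rcases lt_or_ge (Y v') (chordHeight X Y v a (X v')) with h | h
  · have := D.chordHeight_le_of_lt W'.adj_upper W.adj_lower (x₀ := X v') (x₁ := X w)
      (by linarith) (by linarith) (by linarith) (by linarith) (by linarith) (by linarith)
      (by linarith) (by linarith) (by rwa [chordHeight_left])
    linarith
  · have h := W.leftmost v' hlt W'.lt_apex h
    have := D.chordHeight_le_of_lt W.adj_upper W'.adj_lower (x₀ := X v') (x₁ := X w)
      (by linarith) (by linarith) (by linarith) (by linarith) (by linarith) (by linarith)
      (by linarith) (by linarith) (by rwa [chordHeight_left])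
    linarith

/-- If `w` ends the lower edge of one wedge, an edge arrives at `w` from the left, so `w` cannot be
interior to the other. Once the apices agree, the slope of `v w` lies in both slope intervals. -/
theorem eq_of_ne_upper (D : IsPlaneDrawing X Y G) {v' a' b' : V} (W : IsWedge X Y G v a b w)
    (W' : IsWedge X Y G v' a' b' w) (hwb : w ≠ b) (hwb' : w ≠ b') : v = v' ∧ a = a' := by
  have hv : v = v' := by
    by_cases hwa : w = a
    · subst hwa
      by_cases hwa' : w = a'
      · subst hwa'
        exact W.lower_unique D W'
      · exact absurd W.adj_lower (W'.not_adj_left D hwa' hwb' W.lt_apex)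
    · by_cases hwa' : w = a'
      · subst hwa'
        exact absurd W'.adj_lower (W.not_adj_left D hwa hwb W'.lt_apex)
      · apply D.injective
        exact le_antisymm (not_lt.1 (W'.not_apex_lt D W hwa' hwb' hwa hwb))
          (not_lt.1 (W.not_apex_lt D W' hwa hwb hwa' hwb'))
  subst hv
  refine ⟨rfl, W.lower_eq_of_apex_eq D W' ?_ ?_⟩
  · exact W'.lower_le_slope.trans_lt (W.slope_lt_upper (W.lt_upper_height D hwb))
  · exact W.lower_le_slope.trans_lt (W'.slope_lt_upper (W'.lt_upper_height D hwb'))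

theorem eq_of_eq_upper (D : IsPlaneDrawing X Y G) {v' a' : V} (W : IsWedge X Y G v a w w)
    (W' : IsWedge X Y G v' a' w w) : v = v' ∧ a = a' := by
  obtain rfl : v = v' := W.neg.lower_unique D.neg W'.neg
  exact ⟨rfl, W.lower_eq_of_apex_eq D W' W'.slope_lt W.slope_lt⟩

end IsWedge

namespace IsPlaneDrawing

variable {V : Type*} {X Y : V → ℝ} {G : SimpleGraph V}

theorem exists_isWedge [Finite V] {v a c : V} (hva : G.Adj v a)
    (ha : X v < X a) (hvc : G.Adj v c) (hc : X v < X c)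
    (hlt : chordSlope X Y v a < chordSlope X Y v c) : ∃ b w, IsWedge X Y G v a b w := by
  obtain ⟨b, ⟨hvb, hb, hab⟩, hmin⟩ := Set.exists_min_image
    {b | G.Adj v b ∧ X v < X b ∧ chordSlope X Y v a < chordSlope X Y v b} (chordSlope X Y v)
    (Set.toFinite _) ⟨c, hvc, hc, hlt⟩
  -- The end of smaller abscissa, `a` or `b`, lies in the strip.
  have hne : {u | X v < X u ∧ X u ≤ X a ∧ X u ≤ X b ∧ chordHeight X Y v a (X u) ≤ Y u ∧
      Y u ≤ chordHeight X Y v b (X u)}.Nonempty := by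
    have ea : chordHeight X Y v a (X a) = Y a := chordHeight_right ha.ne
    have eb : chordHeight X Y v b (X b) = Y b := chordHeight_right hb.ne
    rcases le_total (X a) (X b) with h | h
    · refine ⟨a, ha, le_rfl, h, ea.le, ?_⟩
      unfold chordHeight at *
      nlinarith
    · refine ⟨b, hb, h, le_rfl, ?_, eb.ge⟩
      unfold chordHeight at *
      nlinarith
  obtain ⟨w, ⟨h1, h2, h3, h4, h5⟩, hw⟩ := Set.exists_min_image _ X (Set.toFinite _) hne
  refine ⟨b, w, hva, hvb, hab, fun d hd hd' => ?_, h1, h2, h3, h4, h5, fun u hu hu' hl => ?_⟩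
  · by_contra! hcon
    exact absurd (hmin d ⟨hd, hd', hcon.1⟩) (not_le.2 hcon.2)
  · by_contra! hcon
    exact absurd (hw u ⟨hu, hu'.le.trans h2, hu'.le.trans h3, hl, hcon⟩) (not_le.2 hu')

open Classical in
/-- A plane drawing has at most three edges per vertex. -/
theorem card_edges_le [Fintype V] (D : IsPlaneDrawing X Y G) :
    (Finset.univ.filter fun e : V × V => G.Adj e.1 e.2 ∧ X e.1 < X e.2).card
      ≤ 3 * Fintype.card V := by
  -- The charge of an edge: label 0 at its left end if it is the top edge leaving there; otherwise
  -- at the first vertex of the wedge above it, with label 2 if that is the upper end and 1 if not.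
  -- Each label is used at most once per vertex.
  have hex : ∀ e : V × V, ∃ t : V × Fin 3, G.Adj e.1 e.2 ∧ X e.1 < X e.2 →
      (t.2 = 0 ∧ t.1 = e.1 ∧ ∀ c, G.Adj e.1 c → X e.1 < X c →
        chordSlope X Y e.1 c ≤ chordSlope X Y e.1 e.2) ∨
      (t.2 = 1 ∧ ∃ b, IsWedge X Y G e.1 e.2 b t.1 ∧ t.1 ≠ b) ∨
      (t.2 = 2 ∧ IsWedge X Y G e.1 e.2 t.1 t.1) := by
    intro e
    by_cases htop : ∀ c, G.Adj e.1 c → X e.1 < X c →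
        chordSlope X Y e.1 c ≤ chordSlope X Y e.1 e.2
    · exact ⟨(e.1, 0), fun _ => Or.inl ⟨rfl, rfl, htop⟩⟩
    · push Not at htop
      obtain ⟨c, hc, hc', hlt⟩ := htop
      by_cases he : G.Adj e.1 e.2 ∧ X e.1 < X e.2
      · obtain ⟨b, w, W⟩ := exists_isWedge he.1 he.2 hc hc' hlt
        by_cases hwb : w = b
        · subst hwb
          exact ⟨(w, 2), fun _ => Or.inr (Or.inr ⟨rfl, W⟩)⟩
        · exact ⟨(w, 1), fun _ => Or.inr (Or.inl ⟨rfl, b, W, hwb⟩)⟩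
      -- Arbitrary value for a pair that is not an edge going right.
      · exact ⟨(c, 0), fun h => absurd h he⟩
  choose t ht using hex
  have hcard : Fintype.card (V × Fin 3) = 3 * Fintype.card V := by
    rw [Fintype.card_prod, Fintype.card_fin, mul_comm]
  rw [← hcard]
  refine Finset.card_le_card_of_injOn t (fun _ _ => Finset.mem_univ _) ?_
  rintro ⟨v, a⟩ he ⟨v', a'⟩ he' htt
  simp only [Finset.coe_filter, Finset.mem_univ, true_and, Set.mem_ofPred_eq] at he he'
  have h := ht (v, a) he
  have h' := ht (v', a') he'
  rw [← htt] at h'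
  dsimp only at h h'
  rcases h with ⟨h0, h1, h2⟩ | ⟨h0, b, W, hb⟩ | ⟨h0, W⟩
  · rcases h' with ⟨-, h1', h2'⟩ | ⟨h0', -⟩ | ⟨h0', -⟩
    · obtain rfl : v = v' := h1.symm.trans h1'
      by_contra hne
      exact D.chordSlope_ne he.1.ne he'.1.ne (fun e => hne (by rw [e]))
        (le_antisymm (h2' a he.1 he.2) (h2 a' he'.1 he'.2))
    · simp [h0] at h0'
    · simp [h0] at h0'
  · rcases h' with ⟨h0', -⟩ | ⟨-, b', W', hb'⟩ | ⟨h0', -⟩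
    · simp [h0] at h0'
    · obtain ⟨rfl, rfl⟩ := W.eq_of_ne_upper D W' hb hb'
      rfl
    · simp [h0] at h0'
  · rcases h' with ⟨h0', -⟩ | ⟨h0', -⟩ | ⟨-, W'⟩
    · simp [h0] at h0'
    · simp [h0] at h0'
    · obtain ⟨rfl, rfl⟩ := W.eq_of_eq_upper D W'
      rfl

open Classical in
theorem sum_degree_le [Fintype V] (D : IsPlaneDrawing X Y G) :
    ∑ v, G.degree v ≤ 6 * Fintype.card V := by
  have h1 := D.card_edges_le
  have h2 : ∑ v, G.degree v = (Finset.univ.filter fun e : V × V => G.Adj e.1 e.2).card := by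
    rw [← Finset.univ_product_univ, Finset.card_filter, Finset.sum_product]
    refine Finset.sum_congr rfl fun v _ => ?_
    rw [← Finset.card_filter, ← G.card_neighborFinset_eq_degree]
    congr 1
    ext w
    simp
  have h3 : (Finset.univ.filter fun e : V × V => G.Adj e.1 e.2) =
      (Finset.univ.filter fun e : V × V => G.Adj e.1 e.2 ∧ X e.1 < X e.2) ∪
      (Finset.univ.filter fun e : V × V => G.Adj e.1 e.2 ∧ X e.1 < X e.2).image Prod.swap := by
    ext ⟨u, v⟩
    simp only [Finset.mem_filter, Finset.mem_univ, true_and, Finset.mem_union, Finset.mem_image,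
      Prod.exists, Prod.swap_prod_mk, Prod.mk.injEq]
    constructor
    · intro h
      rcases lt_or_gt_of_ne (fun e => h.ne (D.injective e) : X u ≠ X v) with h' | h'
      · exact Or.inl ⟨h, h'⟩
      · exact Or.inr ⟨v, u, ⟨h.symm, h'⟩, rfl, rfl⟩
    · rintro (h | ⟨_, _, h, rfl, rfl⟩)
      · exact h.1
      · exact h.1.symm
  rw [h2, h3]
  refine (Finset.card_union_le _ _).trans ?_
  have := Finset.card_image_le (f := Prod.swap)
    (s := Finset.univ.filter fun e : V × V => G.Adj e.1 e.2 ∧ X e.1 < X e.2)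
  omega

end IsPlaneDrawing

/-! ### Visible vertices -/

/-- No edge over `p` separates `u`, to the right of `p`, from `p`. -/
def IsUnseparated {V : Type*} (X Y : V → ℝ) (G : SimpleGraph V) (p u : V) : Prop :=
  ∀ c d, G.Adj c d → X c < X p → X p < X d → X u ≤ X d →
    (Y p < chordHeight X Y c d (X p) → Y u ≤ chordHeight X Y c d (X u)) ∧
    (chordHeight X Y c d (X p) < Y p → chordHeight X Y c d (X u) ≤ Y u)

theorem isUnseparated_neg {V : Type*} {X Y : V → ℝ} {G : SimpleGraph V} {p u : V} :
    IsUnseparated X (-Y) G p u ↔ IsUnseparated X Y G p u := by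
  simp only [IsUnseparated, chordHeight_neg, Pi.neg_apply, neg_lt_neg_iff, neg_le_neg_iff]
  exact forall₂_congr fun c d => by tauto

namespace IsPlaneDrawing

variable {V : Type*} {X Y : V → ℝ} {G : SimpleGraph V} {p w c d : V} {x : ℝ}

/-- The right end of the lowest edge above `p` is not separated from `p`. -/
theorem exists_lowest_above [Finite V] (D : IsPlaneDrawing X Y G)
    (hcd : G.Adj c d) (hc : X c < X p) (hd : X p < X d) (h : Y p < chordHeight X Y c d (X p)) :
    ∃ c' d', G.Adj c' d' ∧ X c' < X p ∧ X p < X d' ∧ Y p < chordHeight X Y c' d' (X p) ∧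
      chordHeight X Y c' d' (X p) ≤ chordHeight X Y c d (X p) ∧ IsUnseparated X Y G p d' := by
  obtain ⟨⟨a, b⟩, ⟨hab, ha, hb, hpab⟩, hmin⟩ := Set.exists_min_image
    {e : V × V | G.Adj e.1 e.2 ∧ X e.1 < X p ∧ X p < X e.2 ∧ Y p < chordHeight X Y e.1 e.2 (X p)}
    (fun e => chordHeight X Y e.1 e.2 (X p)) (Set.toFinite _) ⟨(c, d), hcd, hc, hd, h⟩
  have hr : chordHeight X Y a b (X b) = Y b := chordHeight_right (ha.trans hb).ne
  refine ⟨a, b, hab, ha, hb, hpab, hmin (c, d) ⟨hcd, hc, hd, h⟩, fun c' d' h' hc' hd' hbd => ?_⟩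
  -- An edge above `p` is above `a b` by minimality, and one below `p` is below `a b`; both orders
  -- persist up to `X b`.
  refine ⟨fun hab' => ?_, fun hbe => ?_⟩
  · have := D.chordHeight_le_of_le hab h' (x₁ := X b) ha hb hc' hd' (ha.trans hb).le le_rfl
      (hc'.trans hb).le hbd (hmin (c', d') ⟨h', hc', hd', hab'⟩)
    rwa [hr] at this
  · have := D.chordHeight_le_of_le h' hab (x₁ := X b) hc' hd' ha hb (hc'.trans hb).le hbd
      (ha.trans hb).le le_rfl (hbe.trans hpab).le
    rwa [hr] at this

/-- The leftmost vertex to the right of `p` that is not separated from `p`. -/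
def IsFirst (X Y : V → ℝ) (G : SimpleGraph V) (p w : V) : Prop :=
  X p < X w ∧ IsUnseparated X Y G p w ∧ ∀ u, X p < X u → IsUnseparated X Y G p u → X w ≤ X u

/-- A candidate is the right end of the lowest edge above `p`, or of the highest edge below `p`; if
no edge passes above or below `p`, then `r` itself. -/
theorem exists_isFirst [Finite V] (D : IsPlaneDrawing X Y G) {r : V} (hr : X p < X r) :
    ∃ w, IsFirst X Y G p w := by
  have hne : {u | X p < X u ∧ IsUnseparated X Y G p u}.Nonempty := by
    by_cases h : ∃ c d, G.Adj c d ∧ X c < X p ∧ X p < X d ∧ Y p < chordHeight X Y c d (X p)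
    · obtain ⟨c, d, h1, h2, h3, h4⟩ := h
      obtain ⟨-, d', -, -, h5, -, -, h6⟩ := D.exists_lowest_above h1 h2 h3 h4
      exact ⟨d', h5, h6⟩
    by_cases h' : ∃ c d, G.Adj c d ∧ X c < X p ∧ X p < X d ∧ chordHeight X Y c d (X p) < Y p
    · obtain ⟨c, d, h1, h2, h3, h4⟩ := h'
      obtain ⟨-, d', -, -, h5, -, -, h6⟩ := D.neg.exists_lowest_above h1 h2 h3
        (by simpa [chordHeight_neg] using h4)
      exact ⟨d', h5, isUnseparated_neg.1 h6⟩
    · exact ⟨r, hr, fun c d h1 h2 h3 _ => ⟨fun h4 => absurd ⟨c, d, h1, h2, h3, h4⟩ h,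
        fun h4 => absurd ⟨c, d, h1, h2, h3, h4⟩ h'⟩⟩
  obtain ⟨w, ⟨h1, h2⟩, hw⟩ := Set.exists_min_image _ X (Set.toFinite _) hne
  exact ⟨w, h1, h2, fun u hu hu' => hw u ⟨hu, hu'⟩⟩

theorem IsFirst.neg (F : IsFirst X Y G p w) : IsFirst X (-Y) G p w :=
  ⟨F.1, isUnseparated_neg.2 F.2.1, fun u hu hu' => F.2.2 u hu (isUnseparated_neg.1 hu')⟩

/-- An edge above `p` forces an edge above the whole segment from `p` to the first vertex. -/
theorem IsFirst.exists_above [Finite V] (F : IsFirst X Y G p w) (D : IsPlaneDrawing X Y G)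
    (hcd : G.Adj c d) (hc : X c < X p) (hd : X p < X d) (h : Y p < chordHeight X Y c d (X p)) :
    ∃ c' d', G.Adj c' d' ∧ X c' < X p ∧ X p < X d' ∧ X w ≤ X d' ∧
      chordHeight X Y c' d' (X p) ≤ chordHeight X Y c d (X p) ∧
      ∀ x, X p ≤ x → x < X w → chordHeight X Y p w x < chordHeight X Y c' d' x := by
  obtain ⟨c', d', h1, h2, h3, h4, h5, h6⟩ := D.exists_lowest_above hcd hc hd h
  have hwd := F.2.2 d' h3 h6
  refine ⟨c', d', h1, h2, h3, hwd, h5, fun x hx hx' => ?_⟩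
  refine chordHeight_lt_of_between hx hx' (by rwa [chordHeight_left]) ?_
  rw [chordHeight_right F.1.ne]
  exact (F.2.1 c' d' h1 h2 h3 hwd).1 h4

/-- The edge `c' d'` from `IsFirst.exists_above` runs strictly above the segment and never above `c
d`. -/
theorem IsFirst.ne_of_spanning [Finite V] (F : IsFirst X Y G p w) (D : IsPlaneDrawing X Y G)
    (hcd : G.Adj c d) (hc : X c < X p) (hp : X p < x) (hw : x < X w) (hd : x < X d)
    (h : Y p < chordHeight X Y c d (X p)) :
    chordHeight X Y p w x ≠ chordHeight X Y c d x := by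
  obtain ⟨c', d', h1, h2, h3, h4, h5, h6⟩ := F.exists_above D hcd hc (hp.trans hd) h
  have := D.chordHeight_le_of_le h1 hcd (x₁ := x) h2 h3 hc (hp.trans hd) (h2.trans hp).le
    (hw.le.trans h4) (hc.trans hp).le hd.le h5
  exact ((h6 x hp.le hw).trans_le this).ne

/-- The edge `a b` lies above `p` and below `c`. Then `c' d'`, never above `a b`, also passes below
`c`, so it lies between the segment and `c d`. -/
theorem IsFirst.ne_of_separated [Finite V] (F : IsFirst X Y G p w) (D : IsPlaneDrawing X Y G)
    {a b : V} (hab : G.Adj a b) (ha : X a < X p) (h : Y p < chordHeight X Y a b (X p))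
    (hcb : X c ≤ X b) (hY : chordHeight X Y a b (X c) < Y c)
    (hcd : G.Adj c d) (hpc : X p < X c) (hc : X c < x) (hw : x < X w) (hd : x < X d) :
    chordHeight X Y p w x ≠ chordHeight X Y c d x := by
  obtain ⟨c', d', h1, h2, h3, h4, h5, h6⟩ := F.exists_above D hab ha (hpc.trans_le hcb) h
  have e1 := D.chordHeight_le_of_le h1 hab (x₁ := X c) h2 h3 ha (hpc.trans_le hcb)
    (h2.trans hpc).le (by linarith) (ha.trans hpc).le hcb h5
  have e2 := D.chordHeight_le_of_lt h1 hcd (x₀ := X c) (x₁ := x) (h2.trans hpc).le (by linarith)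
    le_rfl (hc.trans hd).le (by linarith) (by linarith) hc.le hd.le
    (by rw [chordHeight_left]; exact e1.trans_lt hY)
  exact ((h6 x (by linarith) hw).trans_le e2).ne

/-- No edge blocks the segment from an isolated vertex `p` to the first vertex. -/
theorem IsFirst.chordHeight_ne [Finite V] (F : IsFirst X Y G p w) (D : IsPlaneDrawing X Y G)
    (hp : ∀ q, ¬ G.Adj p q) (hcd : G.Adj c d) (h1 : X p < x) (h2 : x < X w) (h3 : X c < x)
    (h4 : x < X d) : chordHeight X Y p w x ≠ chordHeight X Y c d x := by
  have hcp : c ≠ p := by rintro rfl; exact hp _ hcd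
  rcases lt_or_gt_of_ne (fun e => hcp (D.injective e) : X c ≠ X p) with hc | hc
  · have hne := D.general c d p hcd.ne hcp (fun e => (h1.trans h4).ne (congrArg X e.symm))
    rcases lt_or_gt_of_ne hne with h | h
    · have := F.neg.ne_of_spanning D.neg hcd hc h1 h2 h4 (by simpa [chordHeight_neg] using h)
      simpa [chordHeight_neg] using this
    · exact F.ne_of_spanning D hcd hc h1 h2 h4 h
  -- An edge starting between `p` and `w` starts at a vertex that, by minimality of `w`, some edge
  -- separates from `p`.
  · have hu : ¬ IsUnseparated X Y G p c := fun hu =>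
      absurd (F.2.2 c hc hu) (not_le.2 (h3.trans h2))
    unfold IsUnseparated at hu
    push Not at hu
    obtain ⟨a, b, hab, ha, hb, hcb, h⟩ := hu
    by_cases h' : Y p < chordHeight X Y a b (X p) ∧ chordHeight X Y a b (X c) < Y c
    · exact F.ne_of_separated D hab ha h'.1 hcb h'.2 hcd hc h3 h2 h4
    · have h'' : chordHeight X Y a b (X p) < Y p ∧ Y c < chordHeight X Y a b (X c) := by
        grind
      have := F.neg.ne_of_separated D.neg hab ha (by simpa [chordHeight_neg] using h''.1) hcb
        (by simpa [chordHeight_neg] using h''.2) hcd hc h3 h2 h4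
      simpa [chordHeight_neg] using this

end IsPlaneDrawing

/-! ### Coordinates in the plane -/

section Coordinates

variable {X Y : Plane →ₗ[ℝ] ℝ} {a b c z : Plane} {x : ℝ}

theorem chordHeight_of_mem_openSegment (hab : X a < X b) (hz : z ∈ openSegment ℝ a b) :
    X a < X z ∧ X z < X b ∧ chordHeight X Y a b (X z) = Y z := by
  obtain ⟨s, t, hs, ht, hst, rfl⟩ := hz
  obtain rfl : s = 1 - t := by linarith
  have h : X b - X a ≠ 0 := (sub_pos.2 hab).ne'
  simp only [map_add, map_smul, smul_eq_mul, chordHeight, chordSlope]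
  refine ⟨by nlinarith, by nlinarith, ?_⟩
  field_simp
  ring

theorem eq_of_coordinates_eq (hXY : ∀ v, X v = 0 → Y v = 0 → v = 0) (h : X a = X b)
    (h' : Y a = Y b) : a = b :=
  sub_eq_zero.1 (hXY _ (by rw [map_sub, h, sub_self]) (by rw [map_sub, h', sub_self]))

theorem eq_lineMap_of_chordHeight (hXY : ∀ v, X v = 0 → Y v = 0 → v = 0) (hab : X a ≠ X b)
    (h : chordHeight X Y a b (X c) = Y c) :
    c = AffineMap.lineMap a b ((X c - X a) / (X b - X a)) := by
  have hne : X b - X a ≠ 0 := sub_ne_zero.2 hab.symm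
  rw [AffineMap.lineMap_apply_module']
  apply eq_of_coordinates_eq hXY
  · simp only [map_add, map_smul, map_sub, smul_eq_mul]
    field_simp
    ring
  · rw [← h]
    simp only [map_add, map_smul, map_sub, smul_eq_mul, chordHeight, chordSlope]
    ring

theorem exists_mem_openSegment (hax : X a < x) (hxb : x < X b) :
    ∃ z ∈ openSegment ℝ a b, X z = x ∧ Y z = chordHeight X Y a b x := by
  have hne : X b - X a ≠ 0 := by linarith
  have hpos : 0 < X b - X a := by linarith
  refine ⟨(1 - (x - X a) / (X b - X a)) • a + ((x - X a) / (X b - X a)) • b,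
    ⟨_, _, ?_, div_pos (by linarith) hpos, by ring, rfl⟩, ?_, ?_⟩
  · rw [sub_pos, div_lt_one hpos]
    linarith
  · simp only [map_add, map_smul, smul_eq_mul]
    field_simp
    ring
  · simp only [map_add, map_smul, smul_eq_mul, chordHeight, chordSlope]
    ring

theorem IsPlaneGraph.isPlaneDrawing {S : Finset Plane} (hS : InGeneralPosition S)
    {G : SimpleGraph S} (hG : IsPlaneGraph G) (hXY : ∀ v, X v = 0 → Y v = 0 → v = 0)
    (hinj : Set.InjOn X S) :
    IsPlaneDrawing (fun p : S => X p) (fun p : S => Y p) G where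
  injective a b h := Subtype.ext (hinj a.2 b.2 h)
  general a b c hab hac hbc h := by
    refine hS a a.2 b b.2 c c.2 (Subtype.coe_ne_coe.2 hab) (Subtype.coe_ne_coe.2 hac)
      (Subtype.coe_ne_coe.2 hbc) ?_
    have hX : X a ≠ X b := fun e => hab (Subtype.ext (hinj a.2 b.2 e))
    have hmem : (c : Plane) ∈ affineSpan ℝ {(a : Plane), (b : Plane)} := by
      rw [eq_lineMap_of_chordHeight hXY hX h]
      exact AffineMap.lineMap_mem_affineSpan_pair _ _ _
    have := collinear_insert_of_mem_affineSpan_pair hmem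
    rwa [Set.insert_comm, Set.pair_comm (c : Plane)] at this
  noncrossing a b c d hab hcd h1 h2 hne x h3 h4 h5 h6 h := by
    obtain ⟨z, hz, hzx, hzy⟩ := exists_mem_openSegment (Y := Y) h3 h4
    obtain ⟨z', hz', hzx', hzy'⟩ := exists_mem_openSegment (Y := Y) h5 h6
    obtain rfl : z = z' := eq_of_coordinates_eq hXY (hzx.trans hzx'.symm)
      (hzy.trans (h.trans hzy'.symm))
    exact Set.disjoint_left.1 (hG a b c d hab hcd hne) hz hz'

/-- There are coordinates without vertical lines through two points of `S`, in which the first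
coordinate of `p` lies between those of `q` and `r`. -/
theorem exists_coordinates (S : Finset Plane) {p q r : Plane} (hpq : p ≠ q)
    (h : ¬ Collinear ℝ ({p, q, r} : Set Plane)) :
    ∃ X Y : Plane →ₗ[ℝ] ℝ, (∀ v, X v = 0 → Y v = 0 → v = 0) ∧ Set.InjOn X S ∧
      X q < X p ∧ X p < X r := by
  set u := q - p with hu
  set v := r - p with hv
  have hD : u 0 * v 1 - u 1 * v 0 ≠ 0 := by
    intro hD
    apply h
    have hmem : r ∈ affineSpan ℝ {p, q} := by
      have hs : ∃ s : ℝ, v = s • u := by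
        have hne : u ≠ 0 := sub_ne_zero.2 hpq.symm
        by_cases h0 : u 0 = 0
        · have h1 : u 1 ≠ 0 := by
            intro h1
            apply hne
            ext i
            fin_cases i <;> simp [h0, h1]
          refine ⟨v 1 / u 1, ?_⟩
          ext i
          fin_cases i
          · simp only [Fin.zero_eta, PiLp.smul_apply, smul_eq_mul]
            field_simp
            linarith
          · simp only [Fin.mk_one, PiLp.smul_apply, smul_eq_mul]
            field_simp
        · refine ⟨v 0 / u 0, ?_⟩
          ext i
          fin_cases i
          · simp only [Fin.zero_eta, PiLp.smul_apply, smul_eq_mul]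
            field_simp
          · simp only [Fin.mk_one, PiLp.smul_apply, smul_eq_mul]
            field_simp
            linarith
      obtain ⟨s, hs⟩ := hs
      have : r = AffineMap.lineMap p q s := by
        rw [AffineMap.lineMap_apply_module', ← hu, ← hs, hv, sub_add_cancel]
      rw [this]
      exact AffineMap.lineMap_mem_affineSpan_pair _ _ _
    have := collinear_insert_of_mem_affineSpan_pair hmem
    rwa [Set.insert_comm, Set.pair_comm r] at this
  set D := u 0 * v 1 - u 1 * v 0 with hDdef
  -- Up to the factor `D * D`, the forms `α` and `β` are the basis dual to `u`, `v`. Hence `-α + t •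
  -- β` is negative at `u` and positive at `v` for every `t > 0`.
  let π (i : Fin 2) : Plane →ₗ[ℝ] ℝ := (EuclideanSpace.proj i : Plane →L[ℝ] ℝ).toLinearMap
  let α : Plane →ₗ[ℝ] ℝ := D • (v 1 • π 0 - v 0 • π 1)
  let β : Plane →ₗ[ℝ] ℝ := D • (u 0 • π 1 - u 1 • π 0)
  have hα : ∀ z, α z = D * (v 1 * z 0 - v 0 * z 1) := fun z => by simp [α, π]
  have hβ : ∀ z, β z = D * (u 0 * z 1 - u 1 * z 0) := fun z => by simp [β, π]
  have hαβ : ∀ z, α z = 0 → β z = 0 → z = 0 := by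
    intro z h1 h2
    rw [hα, mul_eq_zero, or_iff_right hD] at h1
    rw [hβ, mul_eq_zero, or_iff_right hD] at h2
    have e0 : D * z 0 = 0 := by rw [hDdef]; linear_combination u 0 * h1 + v 0 * h2
    have e1 : D * z 1 = 0 := by rw [hDdef]; linear_combination u 1 * h1 + v 1 * h2
    rw [mul_eq_zero, or_iff_right hD] at e0 e1
    ext i
    fin_cases i <;> simp [e0, e1]
  -- Two points of `S` can share a first coordinate only for finitely many `t`, which are avoided.
  obtain ⟨t, ht, htF⟩ := (Set.Ioi_infinite (0 : ℝ)).exists_notMem_finset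
    ((S ×ˢ S).image fun e => α (e.1 - e.2) / β (e.1 - e.2))
  rw [Set.mem_Ioi] at ht
  refine ⟨-α + t • β, β, ?_, ?_, ?_, ?_⟩
  · intro z h1 h2
    refine hαβ z ?_ h2
    simpa [h2] using h1
  · intro a ha b hb hab
    have h1 : -α (a - b) + t * β (a - b) = 0 := by
      simp only [LinearMap.add_apply, LinearMap.neg_apply, LinearMap.smul_apply, smul_eq_mul] at hab
      rw [map_sub, map_sub]
      linarith
    by_cases h2 : β (a - b) = 0
    · exact sub_eq_zero.1 (hαβ _ (by rwa [h2, mul_zero, add_zero, neg_eq_zero] at h1) h2)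
    · refine absurd (Finset.mem_image.2 ⟨(a, b), Finset.mk_mem_product ha hb, ?_⟩) htF
      rw [div_eq_iff h2]
      linarith
  · have : (-α + t • β) u = -(D * D) := by
      simp only [LinearMap.add_apply, LinearMap.neg_apply, LinearMap.smul_apply, smul_eq_mul, hα,
        hβ]
      rw [hDdef]; ring
    have h2 : 0 < D * D := mul_self_pos.2 hD
    rw [hu, map_sub] at this
    linarith
  · have : (-α + t • β) v = t * (D * D) := by
      simp only [LinearMap.add_apply, LinearMap.neg_apply, LinearMap.smul_apply, smul_eq_mul, hα,
        hβ]
      rw [hDdef]; ring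
    have h2 : 0 < t * (D * D) := mul_pos ht (mul_self_pos.2 hD)
    rw [hv, map_sub] at this
    linarith

end Coordinates

/-! ### Isolated points -/

open Classical in
/-- The points that can be joined to `p` without crossing an edge of `G`. -/
noncomputable def visiblePoints {S : Finset Plane} (G : SimpleGraph S) (p : S) : Finset S :=
  Finset.univ.filter fun q => q ≠ p ∧ ∀ c d : S, G.Adj c d →
    Disjoint (openSegment ℝ (p : Plane) (q : Plane)) (openSegment ℝ (c : Plane) (d : Plane))

theorem mem_visiblePoints {S : Finset Plane} {G : SimpleGraph S} {p q : S} :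
    q ∈ visiblePoints G p ↔ q ≠ p ∧ ∀ c d : S, G.Adj c d →
      Disjoint (openSegment ℝ (p : Plane) (q : Plane)) (openSegment ℝ (c : Plane) (d : Plane)) := by
  simp [visiblePoints]

theorem exists_visible_right {S : Finset Plane} (hS : InGeneralPosition S) {G : SimpleGraph S}
    (hG : IsPlaneGraph G) {X Y : Plane →ₗ[ℝ] ℝ} (hXY : ∀ v, X v = 0 → Y v = 0 → v = 0)
    (hinj : Set.InjOn X S) {p r : S} (hp : ∀ q, ¬ G.Adj p q) (hr : X p < X r) :
    ∃ w ∈ visiblePoints G p, X p < X w := by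
  have D := hG.isPlaneDrawing hS hXY hinj
  obtain ⟨w, F⟩ := D.exists_isFirst (p := p) (r := r) hr
  have hpw : X p < X w := F.1
  refine ⟨w, mem_visiblePoints.2 ⟨fun e => hpw.ne (by rw [e]), ?_⟩, hpw⟩
  have key : ∀ c d : S, G.Adj c d → X c < X d →
      Disjoint (openSegment ℝ (p : Plane) (w : Plane))
        (openSegment ℝ (c : Plane) (d : Plane)) := by
    intro c d hcd hlt
    rw [Set.disjoint_left]
    intro z hz hz'
    obtain ⟨h1, h2, h3⟩ := chordHeight_of_mem_openSegment (Y := Y) hpw hz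
    obtain ⟨h4, h5, h6⟩ := chordHeight_of_mem_openSegment (Y := Y) hlt hz'
    exact F.chordHeight_ne D hp hcd h1 h2 h4 h5 (h3.trans h6.symm)
  intro c d hcd
  rcases lt_or_gt_of_ne (fun e => hcd.ne (Subtype.ext (hinj c.2 d.2 e)) : X c ≠ X d) with h | h
  · exact key c d hcd h
  · rw [openSegment_symm ℝ (c : Plane)]
    exact key d c hcd.symm h

/-- With the first coordinate of `p` strictly between those of two other points, there is a visible
point on the right and, replacing `X` by `-X`, one on the left. -/
theorem two_le_card_visiblePoints {S : Finset Plane} (hS : InGeneralPosition S)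
    (hcard : 3 ≤ S.card) {G : SimpleGraph S} (hG : IsPlaneGraph G) {p : S}
    (hp : ∀ q, ¬ G.Adj p q) : 2 ≤ (visiblePoints G p).card := by
  classical
  have h2 : 1 < (S.erase p).card := by rw [Finset.card_erase_of_mem p.2]; omega
  obtain ⟨q, hq, r, hr, hqr⟩ := Finset.one_lt_card.1 h2
  rw [Finset.mem_erase] at hq hr
  obtain ⟨X, Y, hXY, hinj, h1, h2⟩ := exists_coordinates S hq.1.symm
    (hS p p.2 q hq.2 r hr.2 hq.1.symm hr.1.symm hqr)
  obtain ⟨w, hw, hpw⟩ := exists_visible_right hS hG hXY hinj (r := ⟨r, hr.2⟩) hp h2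
  obtain ⟨w', hw', hpw'⟩ := exists_visible_right hS hG (X := -X) (Y := Y)
    (fun v h => hXY v (neg_eq_zero.1 h)) (fun a ha b hb h => hinj ha hb (neg_injective h))
    (r := ⟨q, hq.2⟩) hp (by simpa using h1)
  refine Finset.one_lt_card.2 ⟨w, hw, w', hw', ?_⟩
  rintro rfl
  simp only [LinearMap.neg_apply, neg_lt_neg_iff] at hpw'
  exact lt_asymm hpw hpw'

open Classical in
theorem IsPlaneGraph.sum_degree_le {S : Finset Plane} (hS : InGeneralPosition S)
    (hcard : 3 ≤ S.card) {G : SimpleGraph S} (hG : IsPlaneGraph G) :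
    ∑ p, G.degree p ≤ 6 * S.card := by
  obtain ⟨p, hp, q, hq, r, hr, hpq, hpr, hqr⟩ := Finset.two_lt_card.1 hcard
  obtain ⟨X, Y, hXY, hinj, -, -⟩ := exists_coordinates S hpq (hS p hp q hq r hr hpq hpr hqr)
  simpa using (hG.isPlaneDrawing hS hXY hinj).sum_degree_le

/-! ### Graphs that differ at one point -/

/-- The graph `H` together with edges from `p` to the points of `T`. -/
def addStar {V : Type*} (H : SimpleGraph V) (p : V) (T : Finset V) : SimpleGraph V where
  Adj a b := H.Adj a b ∨ (a = p ∧ b ∈ T ∧ b ≠ p) ∨ (b = p ∧ a ∈ T ∧ a ≠ p)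
  symm := ⟨fun a b h => by
    rcases h with h | h | h
    · exact Or.inl h.symm
    · exact Or.inr (Or.inr h)
    · exact Or.inr (Or.inl h)⟩
  loopless := ⟨fun a h => by
    rcases h with h | h | h
    · exact h.ne rfl
    · exact h.2.2 h.1
    · exact h.2.2 h.1⟩

theorem disjoint_openSegment_of_not_collinear {p q r : Plane}
    (h : ¬ Collinear ℝ ({p, q, r} : Set Plane)) :
    Disjoint (openSegment ℝ p q) (openSegment ℝ p r) := by
  rw [Set.disjoint_left]
  rintro z ⟨s, t, hs, ht, hst, rfl⟩ ⟨s', t', hs', ht', hst', hz⟩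
  apply h
  obtain rfl : s = 1 - t := by linarith
  obtain rfl : s' = 1 - t' := by linarith
  have hmem : r ∈ affineSpan ℝ {p, q} := by
    have : r = AffineMap.lineMap p q (t / t') := by
      have hr : t' • (r - p) = t • (q - p) := by
        have := sub_eq_zero.2 hz
        rw [← sub_eq_zero, ← this]
        module
      rw [AffineMap.lineMap_apply_module', div_eq_inv_mul, mul_smul, ← hr,
        inv_smul_smul₀ ht'.ne', sub_add_cancel]
    rw [this]
    exact AffineMap.lineMap_mem_affineSpan_pair _ _ _
  have := collinear_insert_of_mem_affineSpan_pair hmem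
  rwa [Set.insert_comm, Set.pair_comm r] at this

theorem IsPlaneGraph.mono {S : Finset Plane} {G H : SimpleGraph S} (hG : IsPlaneGraph G)
    (h : H ≤ G) : IsPlaneGraph H :=
  fun a b c d hab hcd hne => hG a b c d (h hab) (h hcd) hne

theorem IsPlaneGraph.addStar {S : Finset Plane} (hS : InGeneralPosition S) {H : SimpleGraph S}
    (hH : IsPlaneGraph H) {p : S} {T : Finset S} (hT : T ⊆ visiblePoints H p) :
    IsPlaneGraph (addStar H p T) := by
  have hvis : ∀ b ∈ T, ∀ c d : S, H.Adj c d →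
      Disjoint (openSegment ℝ (p : Plane) (b : Plane)) (openSegment ℝ (c : Plane) (d : Plane)) :=
    fun b hb => (mem_visiblePoints.1 (hT hb)).2
  have hstar : ∀ b ∈ T, ∀ d ∈ T, b ≠ d →
      Disjoint (openSegment ℝ (p : Plane) (b : Plane)) (openSegment ℝ (p : Plane) (d : Plane)) := by
    intro b hb d hd hbd
    have hbp := (mem_visiblePoints.1 (hT hb)).1
    have hdp := (mem_visiblePoints.1 (hT hd)).1
    exact disjoint_openSegment_of_not_collinear (hS p p.2 b b.2 d d.2
      (Subtype.coe_ne_coe.2 hbp.symm) (Subtype.coe_ne_coe.2 hdp.symm) (Subtype.coe_ne_coe.2 hbd))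
  rintro a b c d (hab | ⟨rfl, hb, -⟩ | ⟨rfl, ha, -⟩) (hcd | ⟨rfl, hd, -⟩ | ⟨rfl, hc, -⟩) hne
  · exact hH a b c d hab hcd hne
  · exact (hvis d hd a b hab).symm
  · rw [openSegment_symm ℝ (c : Plane)]
    exact (hvis c hc a b hab).symm
  · exact hvis b hb c d hcd
  · exact hstar b hb d hd (fun e => hne (by rw [e]))
  · rw [openSegment_symm ℝ (c : Plane)]
    exact hstar b hb c hc (fun e => hne (by rw [e, Sym2.eq_swap]))
  · rw [openSegment_symm ℝ (a : Plane)]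
    exact hvis a ha c d hcd
  · rw [openSegment_symm ℝ (a : Plane)]
    exact hstar a ha d hd (fun e => hne (by rw [e, Sym2.eq_swap]))
  · rw [openSegment_symm ℝ (a : Plane), openSegment_symm ℝ (c : Plane)]
    exact hstar a ha c hc (fun e => hne (by rw [e]))

theorem mem_planeGraphs {S : Finset Plane} {G : SimpleGraph S} :
    G ∈ planeGraphs S ↔ IsPlaneGraph G := by
  simp [planeGraphs]

open Classical in
/-- The plane graphs that agree with `H` away from `p` correspond to the sets of points that are
visible from `p`. -/
theorem sum_planeGraphs_fiber {S : Finset Plane} (hS : InGeneralPosition S) {H : SimpleGraph S}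
    (hH : IsPlaneGraph H) {p : S} (hp : ∀ q, ¬ H.Adj p q) (f : ℕ → ℤ) :
    ∑ G ∈ planeGraphs S with G.deleteIncidenceSet p = H, f (G.degree p) =
      ∑ T ∈ (visiblePoints H p).powerset, f T.card := by
  refine Finset.sum_bij' (fun G _ => G.neighborFinset p) (fun T _ => addStar H p T)
    ?_ ?_ ?_ ?_ ?_
  · intro G hG
    rw [Finset.mem_filter, mem_planeGraphs] at hG
    obtain ⟨hG, rfl⟩ := hG
    rw [Finset.mem_powerset]
    intro q hq
    rw [SimpleGraph.mem_neighborFinset] at hq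
    refine mem_visiblePoints.2 ⟨hq.ne.symm, fun c d hcd => ?_⟩
    rw [SimpleGraph.deleteIncidenceSet_adj] at hcd
    refine hG p q c d hq hcd.1 (fun e => ?_)
    rcases Sym2.eq_iff.1 e with ⟨h, -⟩ | ⟨h, -⟩
    · exact hcd.2.1 h.symm
    · exact hcd.2.2 h.symm
  · intro T hT
    rw [Finset.mem_powerset] at hT
    rw [Finset.mem_filter, mem_planeGraphs]
    refine ⟨hH.addStar hS hT, ?_⟩
    ext a b
    rw [SimpleGraph.deleteIncidenceSet_adj]
    constructor
    · rintro ⟨h | h | h, ha, hb⟩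
      · exact h
      · exact absurd h.1 ha
      · exact absurd h.1 hb
    · intro h
      exact ⟨Or.inl h, fun e => hp b (e ▸ h), fun e => hp a (e ▸ h.symm)⟩
  · intro G hG
    rw [Finset.mem_filter] at hG
    obtain ⟨-, rfl⟩ := hG
    ext a b
    simp only [addStar, SimpleGraph.deleteIncidenceSet_adj, SimpleGraph.mem_neighborFinset]
    constructor
    · rintro (h | ⟨rfl, h, -⟩ | ⟨rfl, h, -⟩)
      · exact h.1
      · exact h
      · exact h.symm
    · intro h
      by_cases ha : a = p
      · subst ha
        exact Or.inr (Or.inl ⟨rfl, h, h.ne.symm⟩)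
      · by_cases hb : b = p
        · subst hb
          exact Or.inr (Or.inr ⟨rfl, h.symm, h.ne⟩)
        · exact Or.inl ⟨h, ha, hb⟩
  · intro T hT
    rw [Finset.mem_powerset] at hT
    ext q
    rw [SimpleGraph.mem_neighborFinset]
    constructor
    · rintro (h | h | h)
      · exact absurd h (hp q)
      · exact h.2.1
      · exact absurd rfl h.2.2
    · intro h
      exact Or.inr (Or.inl ⟨rfl, h, (mem_visiblePoints.1 (hT h)).1⟩)
  · intro G _
    rw [SimpleGraph.card_neighborFinset_eq_degree]

/-! ### The weighted count -/

/-- The weight by which a vertex of degree `m` enters the count. -/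
def degreeWeight (m : ℕ) : ℤ :=
  24 * ((if m = 2 then 1 else 0) + (if m = 3 then 1 else 0)) + m - 7

/-- Equality holds at `k = 2`, where the sum is `-7 - 2·6 + 19`; this fixes the constant 24. For `14
≤ k` the bonus for degrees 2 and 3 can be dropped, since the mean subset size `k / 2` is at least 7.
-/
theorem sum_choose_mul_degreeWeight_nonneg {k : ℕ} (hk : 2 ≤ k) :
    0 ≤ ∑ m ∈ Finset.range (k + 1), k.choose m • degreeWeight m := by
  rcases lt_or_ge k 14 with h | h
  · interval_cases k <;> decide
  · have h1 : ∑ m ∈ Finset.range (k + 1), k.choose m • ((m : ℤ) - 7) ≤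
        ∑ m ∈ Finset.range (k + 1), k.choose m • degreeWeight m := by
      refine Finset.sum_le_sum fun m _ => nsmul_le_nsmul_right ?_ _
      unfold degreeWeight
      split_ifs <;> omega
    refine le_trans ?_ h1
    have h2 : (∑ m ∈ Finset.range (k + 1), (m : ℤ) * (k.choose m : ℤ)) = k * 2 ^ (k - 1) := by
      exact_mod_cast Nat.sum_range_mul_choose k
    have h3 : (∑ m ∈ Finset.range (k + 1), (k.choose m : ℤ)) = 2 ^ k := by
      exact_mod_cast Nat.sum_range_choose k
    have h4 : ∑ m ∈ Finset.range (k + 1), k.choose m • ((m : ℤ) - 7) =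
        k * 2 ^ (k - 1) - 7 * 2 ^ k := by
      rw [← h2, ← h3, Finset.mul_sum, ← Finset.sum_sub_distrib]
      refine Finset.sum_congr rfl fun m _ => ?_
      rw [nsmul_eq_mul]
      ring
    obtain ⟨n, rfl⟩ : ∃ n, k = n + 1 := ⟨k - 1, by omega⟩
    rw [h4, Nat.add_sub_cancel, pow_succ]
    have h5 : (0 : ℤ) < 2 ^ n := by positivity
    have h6 : (14 : ℤ) ≤ ((n + 1 : ℕ) : ℤ) := by exact_mod_cast h
    nlinarith

open Classical in
theorem sum_degreeWeight_nonneg {S : Finset Plane} (hS : InGeneralPosition S)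
    (hcard : 3 ≤ S.card) (p : S) : 0 ≤ ∑ G ∈ planeGraphs S, degreeWeight (G.degree p) := by
  rw [← Finset.sum_fiberwise_of_maps_to (t := (planeGraphs S).image (·.deleteIncidenceSet p))
    (fun G hG => Finset.mem_image_of_mem _ hG)]
  refine Finset.sum_nonneg fun H hH => ?_
  obtain ⟨G, hG, rfl⟩ := Finset.mem_image.1 hH
  have hplane := (mem_planeGraphs.1 hG).mono (G.deleteIncidenceSet_le p)
  have hiso : ∀ q, ¬ (G.deleteIncidenceSet p).Adj p q := fun q h =>
    (SimpleGraph.deleteIncidenceSet_adj.1 h).2.1 rfl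
  rw [sum_planeGraphs_fiber hS hplane hiso, Finset.sum_powerset_apply_card]
  exact sum_choose_mul_degreeWeight_nonneg (two_le_card_visiblePoints hS hcard hplane hiso)

open Classical in
theorem sum_degreeWeight {S : Finset Plane} (G : SimpleGraph S) :
    ∑ p, degreeWeight (G.degree p) =
      24 * ((numDegree G 2 : ℤ) + numDegree G 3) + (∑ p, G.degree p : ℕ) - 7 * S.card := by
  simp only [degreeWeight, numDegree, Finset.card_filter]
  rw [Finset.sum_sub_distrib, Finset.sum_add_distrib, ← Finset.mul_sum, Finset.sum_add_distrib]
  push_cast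
  simp [mul_comm]

theorem mainTheorem10 (N : ℕ) (hN : 3 ≤ N) (S : Finset Plane) (hcard : S.card = N)
    (hS : InGeneralPosition S) :
    expectedNumDegree S 2 + expectedNumDegree S 3 ≥ (N : ℝ) / 24 := by
  classical
  subst hcard
  have h0 : 0 ≤ ∑ G ∈ planeGraphs S,
      (24 * ((numDegree G 2 : ℤ) + numDegree G 3) - S.card) := by
    have h1 : 0 ≤ ∑ p : S, ∑ G ∈ planeGraphs S, degreeWeight (G.degree p) :=
      Finset.sum_nonneg fun p _ => by convert sum_degreeWeight_nonneg hS hN p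
    rw [Finset.sum_comm] at h1
    -- The degree sum is at most `6N`, so of the `-7N` in the total weight at least `-N` is left
    -- over.
    refine h1.trans (Finset.sum_le_sum fun G hG => ?_)
    have h2 := (mem_planeGraphs.1 hG).sum_degree_le hS hN
    have h3 := sum_degreeWeight G
    have h4 : ((∑ p, G.degree p : ℕ) : ℤ) ≤ 6 * S.card := by exact_mod_cast h2
    linarith
  have h1 : (S.card : ℝ) * (planeGraphs S).card ≤
      24 * (∑ G ∈ planeGraphs S, (numDegree G 2 : ℝ) +
        ∑ G ∈ planeGraphs S, (numDegree G 3 : ℝ)) := by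
    rw [Finset.sum_sub_distrib, ← Finset.mul_sum, Finset.sum_add_distrib, Finset.sum_const,
      nsmul_eq_mul] at h0
    have h2 : ((planeGraphs S).card : ℤ) * S.card ≤
      24 * (∑ G ∈ planeGraphs S, (numDegree G 2 : ℤ) +
        ∑ G ∈ planeGraphs S, (numDegree G 3 : ℤ)) := by linarith
    rw [mul_comm]
    exact_mod_cast h2
  have hpos : (0 : ℝ) < (planeGraphs S).card := by
    exact_mod_cast Finset.card_pos.2 (planeGraphs_nonempty S)
  rw [ge_iff_le, expectedNumDegree, expectedNumDegree, ← add_div, le_div_iff₀ hpos]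
  linarith
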